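/- **Theorem 4.2.** A Boolean cell complex $\Delta$ is a finite regular CW complex, with the empty cell included as a cell, such that for every cell $A$ the lower interval $[\emptyset,A]$ in the poset of cells (ordered by containment in closures) is isomorphic to the lattice of all subsets of a finite set. We identify $\Delta$ with its poset of cells: a finite poset with least element $\emptyset$ all of whose lower intervals $[\emptyset,A]$ are Boolean lattices. If $[\emptyset,A]$ is the lattice of subsets of a $k$-element set, then $\dim A=k-1$; the dimension of $\Delta$ is the maximum of the $\dim A$. If $\dim\Delta=d-1$ and $f_i^\Delta$ is the number of cells of dimension $i$, then the $h$-polynomial of $\Delta$ is $$\mathfrak h^\Delta(t)=\sum_{i=0}^{d} f_{i-1}^\Delta\,(t-1)^{d-i}.$$ The barycentric subdivision $\mathrm{sd}(\Delta)$ is the simplicial complex whose faces are the flags (finite chains, including the empty one) of non-empty cells of $\Delta$, ordered by inclusion, and $\mathrm{sd}^n$ is its $n$-fold iterate. Let $d\ge 2$. There are negative real numbers $\alpha_1,\dots,\alpha_{d-2}$, depending only on $d$, such that for every Boolean cell complex $\Delta$ of dimension $d-1$ there are sequences $(\beta_i^{(n)})_{n\ge1}$, $1\le i\le d$, of complex numbers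 with the following properties. 1. For all sufficiently large $n$, the numbers $\beta_1^{(n)},\dots,\beta_d^{(n)}$ are all real. 2. $\lim_{n\to\infty}\beta_i^{(n)}=\alpha_i$ for $1\le i\le d-2$. 3. $\lim_{n\to\infty}\beta_{d-1}^{(n)}=0$. 4. $\lim_{n\to\infty}\beta_d^{(n)}=-\infty$. 5. For all $n\ge1$, $\displaystyle\prod_{i=1}^d\bigl(t-\beta_i^{(n)}\bigr)=\mathfrak h^{\mathrm{sd}^n(\Delta)}(t).$ -/

import Mathlib

open Filter Topology Polynomial

universe u

/-- A (finite) Boolean cell complex, identified with the partially ordered set of its cells ordered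
by containment in closures. The empty cell is the least element `⊥`, and every lower interval
`[∅, A]` is a Boolean lattice, i.e. isomorphic to the lattice of all subsets of a finite set. -/
structure BooleanCellComplex : Type (u + 1) where
  /-- The cells (faces), including the empty cell. -/
  Face : Type u
  [partialOrder : PartialOrder Face]
  [orderBot : OrderBot Face]
  [finite : Finite Face]
  boolean : ∀ A : Face, ∃ k : ℕ, Nonempty (Set.Iic A ≃o Finset (Fin k))

namespace BooleanCellComplex

attribute [instance] partialOrder orderBot finite

/-- The dimension of a face: if `[∅, A]` is the lattice of subsets of a `k`-element set (so that the
longest chain of faces ending in `A` has `k` steps) then `dim A = k - 1`. The empty face has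
dimension `-1`. -/
noncomputable def faceDim (Δ : BooleanCellComplex.{u}) (A : Δ.Face) : ℤ :=
  ((Order.height A).toNat : ℤ) - 1

/-- The dimension of a complex is the maximal dimension of one of its faces. -/
noncomputable def dim (Δ : BooleanCellComplex.{u}) : ℤ :=
  ⨆ A : Δ.Face, Δ.faceDim A

/-- The number `f_i` of `i`-dimensional faces. -/
noncomputable def fNum (Δ : BooleanCellComplex.{u}) (i : ℤ) : ℕ :=
  Nat.card {A : Δ.Face // Δ.faceDim A = i}

/-- The `f`-polynomial `∑_{i=0}^d f_{i-1} t^{d-i}`, where `d = dim Δ + 1`. -/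
noncomputable def fPoly (Δ : BooleanCellComplex.{u}) : ℤ[X] :=
  ∑ i ∈ Finset.range ((Δ.dim + 1).toNat + 1),
    C (Δ.fNum ((i : ℤ) - 1) : ℤ) * X ^ ((Δ.dim + 1).toNat - i)

/-- The `h`-polynomial `h(t) = f(t - 1)`. -/
noncomputable def hPoly (Δ : BooleanCellComplex.{u}) : ℤ[X] :=
  Δ.fPoly.comp (X - 1)

/-- The faces of the barycentric subdivision: the flags (chains) of nonempty faces of `Δ`,
the empty flag included. -/
def Flag (Δ : BooleanCellComplex.{u}) : Type u :=
  {s : Finset Δ.Face // ⊥ ∉ s ∧ IsChain (· ≤ ·) (s : Set Δ.Face)}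

instance (Δ : BooleanCellComplex.{u}) : PartialOrder Δ.Flag :=
  inferInstanceAs (PartialOrder {s : Finset Δ.Face // ⊥ ∉ s ∧ IsChain (· ≤ ·) (s : Set Δ.Face)})

instance (Δ : BooleanCellComplex.{u}) : OrderBot Δ.Flag where
  bot := ⟨∅, by simp⟩
  bot_le s := Finset.empty_subset s.1

instance (Δ : BooleanCellComplex.{u}) : Finite Δ.Flag :=
  inferInstanceAs (Finite {s : Finset Δ.Face // ⊥ ∉ s ∧ IsChain (· ≤ ·) (s : Set Δ.Face)})

theorem Flag.boolean (Δ : BooleanCellComplex.{u}) (s : Δ.Flag) :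
    ∃ k : ℕ, Nonempty (Set.Iic s ≃o Finset (Fin k)) := by
  classical
  let e : Fin s.1.card ≃ s.1 := s.1.equivFin.symm
  let g : Fin s.1.card ↪ Δ.Face := e.toEmbedding.trans (Function.Embedding.subtype _)
  have hg : ∀ i, g i ∈ s.1 := fun i => (e i).2
  have hsurj : ∀ a ∈ s.1, ∃ i, g i = a := fun a ha => ⟨e.symm ⟨a, ha⟩, by simp [g]⟩
  have hsub : ∀ v : Finset (Fin s.1.card), v.map g ⊆ s.1 := fun v a ha => by
    obtain ⟨i, -, rfl⟩ := Finset.mem_map.1 ha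
    exact hg i
  let F : Finset (Fin s.1.card) → Set.Iic s := fun v =>
    ⟨⟨v.map g, fun h => s.2.1 (hsub v h), s.2.2.mono (Finset.coe_subset.2 (hsub v))⟩, hsub v⟩
  have hF : ∀ v w, F v ≤ F w ↔ v ≤ w := fun v w => Finset.map_subset_map
  have hFs : Function.Surjective F := fun t => by
    refine ⟨Finset.univ.filter (fun i => g i ∈ t.1.1), Subtype.ext (Subtype.ext ?_)⟩
    ext a
    simp only [F, Finset.mem_map, Finset.mem_filter, Finset.mem_univ, true_and]
    constructor
    · rintro ⟨i, hi, rfl⟩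
      exact hi
    · intro ha
      obtain ⟨i, rfl⟩ := hsurj a (t.2 ha)
      exact ⟨i, ha, rfl⟩
  exact ⟨s.1.card, ⟨(RelIso.ofSurjective (OrderEmbedding.ofMapLEIff F hF) hFs).symm⟩⟩

/-- The barycentric subdivision: the simplicial complex of flags of nonempty faces of `Δ`,
ordered by inclusion. -/
def sd (Δ : BooleanCellComplex.{u}) : BooleanCellComplex.{u} where
  Face := Δ.Flag
  boolean := Flag.boolean Δ

end BooleanCellComplex

/-! Encode a complex by the polynomial counting its cells by rank. A flag with a given top cell of
rank `i` is an ordered set partition of an `i`-element set, so subdivision acts on this polynomial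
by one linear operator T, `subdivOp`. T is triangular with diagonal entries `i!`. For `d ≥ 2` the
eigenvalue `d!` strictly dominates those of lower degree, so `(d!)⁻ⁿ Tⁿ p` converges to a multiple
of a monic eigenvector `q` of degree `d` that depends only on `d`.

T sends polynomials with all roots in `[-1, 0]` to such polynomials with simple roots. Starting from
`X ^ d`, the limit `q` has all its roots in `[-1, 0]`, and they are simple because `q` is a multiple
of T q. Since T preserves values at `0` and `-1`, both are roots of `q`.

The roots of the `h`-polynomial are `1 + 1/y` for the nonzero roots `y` of the rank polynomial,
together with possible roots at `1`. Thus roots of `q` in `(-1, 0)` give the negative limits, and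
`-1` gives the limit `0`. The remaining root escapes to `-∞`, because the value of the monic
`h`-polynomial at `1` grows like `(d!)ⁿ`. -/

/-! ### Surjection numbers and the subdivision operator -/

/-- The number of surjections from an `i`-element set onto a `j`-element set. -/
def surjCount : ℕ → ℕ → ℕ
  | 0, 0 => 1
  | 0, _ + 1 => 0
  | _ + 1, 0 => 0
  | i + 1, j + 1 => (j + 1) * (surjCount i j + surjCount i (j + 1))

theorem surjCount_eq_zero : ∀ {i j : ℕ}, i < j → surjCount i j = 0
  | 0, 0, h => absurd h (lt_irrefl _)
  | 0, _ + 1, _ => rfl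
  | _ + 1, 0, h => absurd h (Nat.not_lt_zero _)
  | i + 1, j + 1, h => by
    rw [surjCount, surjCount_eq_zero (by omega : i < j), surjCount_eq_zero (by omega : i < j + 1)]
    simp

theorem surjCount_self (i : ℕ) : surjCount i i = i.factorial := by
  induction i with
  | zero => rfl
  | succ i ih =>
    rw [surjCount, ih, surjCount_eq_zero (Nat.lt_succ_self i), Nat.factorial_succ, add_zero]

theorem surjCount_zero_right {i : ℕ} (hi : i ≠ 0) : surjCount i 0 = 0 := by
  cases i with
  | zero => exact absurd rfl hi
  | succ i => rfl

/-- The generating polynomial of `surjCount i`, which counts ordered set partitions of an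
`i`-element set by number of blocks. -/
noncomputable def fubiniPoly : ℕ → ℝ[X]
  | 0 => 1
  | i + 1 => X * derivative ((1 + X) * fubiniPoly i)

theorem coeff_fubiniPoly : ∀ i j : ℕ, (fubiniPoly i).coeff j = surjCount i j
  | 0, 0 => by simp [fubiniPoly, surjCount]
  | 0, j + 1 => by simp [fubiniPoly, surjCount, coeff_one]
  | i + 1, 0 => by simp [fubiniPoly, surjCount]
  | i + 1, j + 1 => by
    rw [fubiniPoly, coeff_X_mul, coeff_derivative, add_mul, one_mul, coeff_add, coeff_X_mul,
      coeff_fubiniPoly, coeff_fubiniPoly, surjCount]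
    push_cast
    ring

/-- The linear operator on polynomials with `X ^ i ↦ fubiniPoly i`. -/
noncomputable def subdivOp : ℝ[X] →ₗ[ℝ] ℝ[X] :=
  (Polynomial.basisMonomials ℝ).constr ℝ fubiniPoly

theorem subdivOp_X_pow (i : ℕ) : subdivOp (X ^ i) = fubiniPoly i := by
  have h := (Polynomial.basisMonomials ℝ).constr_basis ℝ fubiniPoly i
  simpa only [subdivOp, coe_basisMonomials, monomial_one_right_eq_X_pow] using h

theorem subdivOp_X_mul (p : ℝ[X]) :
    subdivOp (X * p) = X * derivative ((1 + X) * subdivOp p) := by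
  induction p using Polynomial.induction_on' with
  | add p q hp hq => rw [mul_add, map_add, hp, hq, map_add, mul_add, derivative_add, mul_add]
  | monomial n a =>
    rw [← C_mul_X_pow_eq_monomial, ← smul_eq_C_mul, mul_smul_comm, map_smul, map_smul,
      ← pow_succ', subdivOp_X_pow, subdivOp_X_pow, mul_smul_comm,
      derivative_smul, mul_smul_comm, fubiniPoly]

theorem subdivOp_C (a : ℝ) : subdivOp (C a) = C a := by
  have h := subdivOp_X_pow 0
  rw [pow_zero] at h
  rw [← mul_one (C a), ← smul_eq_C_mul, map_smul, h]
  rfl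

theorem subdivOp_X : subdivOp X = X := by
  have h := subdivOp_X_mul 1
  rw [mul_one, ← C_1, subdivOp_C] at h
  rw [h]
  simp

/-- A new root of the argument becomes a first-order differential operator on the image. This lets
root location be proved one linear factor at a time. -/
theorem subdivOp_X_sub_C_mul (r : ℝ) (p : ℝ[X]) :
    subdivOp ((X - C r) * p) =
      X * (1 + X) * derivative (subdivOp p) + (X - C r) * subdivOp p := by
  rw [sub_mul, map_sub, subdivOp_X_mul, ← smul_eq_C_mul, map_smul, derivative_mul, smul_eq_C_mul]
  simp only [derivative_add, derivative_one, derivative_X]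
  ring

theorem coeff_subdivOp (p : ℝ[X]) (j : ℕ) :
    (subdivOp p).coeff j = p.sum fun i a => a * surjCount i j := by
  induction p using Polynomial.induction_on' with
  | add p q hp hq =>
    rw [map_add, coeff_add, hp, hq, Polynomial.sum_add_index]
    · simp
    · intros; ring
  | monomial n a =>
    rw [sum_monomial_index _ _ (by simp), ← C_mul_X_pow_eq_monomial, ← smul_eq_C_mul, map_smul,
      subdivOp_X_pow, coeff_smul, coeff_fubiniPoly]
    simp

theorem natDegree_subdivOp_le (p : ℝ[X]) : (subdivOp p).natDegree ≤ p.natDegree := by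
  rw [natDegree_le_iff_coeff_eq_zero]
  intro j hj
  rw [coeff_subdivOp, Polynomial.sum_def]
  refine Finset.sum_eq_zero fun i hi => ?_
  rw [surjCount_eq_zero ((le_natDegree_of_mem_supp i hi).trans_lt hj)]
  simp

theorem coeff_subdivOp_of_natDegree_le {p : ℝ[X]} {d : ℕ} (hp : p.natDegree ≤ d) :
    (subdivOp p).coeff d = d.factorial * p.coeff d := by
  rw [coeff_subdivOp, Polynomial.sum_def]
  rw [Finset.sum_eq_single d]
  · rw [surjCount_self, mul_comm]
  · intro i hi hid
    rw [surjCount_eq_zero (lt_of_le_of_ne ((le_natDegree_of_mem_supp i hi).trans hp) hid)]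
    simp
  · intro h
    rw [notMem_support_iff.1 h, zero_mul]

theorem coeff_zero_subdivOp (p : ℝ[X]) : (subdivOp p).coeff 0 = p.coeff 0 := by
  rw [coeff_subdivOp, Polynomial.sum_def, Finset.sum_eq_single 0]
  · simp [surjCount]
  · intro i _ hi
    simp [surjCount_zero_right hi]
  · intro h
    rw [notMem_support_iff.1 h, zero_mul]

/-- At `-1` the factor `1 + X` survives only when differentiated, so multiplying the argument by `X`
multiplies both sides by `-1`. -/
theorem eval_neg_one_subdivOp (p : ℝ[X]) : (subdivOp p).eval (-1) = p.eval (-1) := by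
  induction p using Polynomial.induction_on with
  | C a => rw [subdivOp_C]
  | add p q hp hq => rw [map_add, eval_add, hp, hq, eval_add]
  | monomial n a h =>
    rw [pow_succ', mul_left_comm, subdivOp_X_mul, derivative_mul]
    simp only [eval_mul, eval_add, eval_X, derivative_add, derivative_one, derivative_X, eval_one,
      eval_zero, h]
    ring

/-! ### Preservation of roots in `[-1, 0]` -/

/-- All complex roots of `p` are real and lie in `[-1, 0]`. -/
def RootsInInterval (p : ℝ[X]) : Prop :=
  ∀ z : ℂ, aeval z p = 0 → ∃ x : ℝ, -1 ≤ x ∧ x ≤ 0 ∧ z = x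

theorem RootsInInterval.ne_zero {p : ℝ[X]} (hp : RootsInInterval p) : p ≠ 0 := by
  rintro rfl
  obtain ⟨x, -, hx, h⟩ := hp 1 (by simp)
  have : (1 : ℝ) = x := by exact_mod_cast h
  linarith

theorem RootsInInterval.splits {p : ℝ[X]} (hp : RootsInInterval p) : p.Splits := by
  refine Splits.of_splits_map (algebraMap ℝ ℂ) (IsAlgClosed.splits _) fun z hz => ?_
  obtain ⟨x, -, -, rfl⟩ := hp z (by
    rw [aeval_def, ← eval_map]; exact (mem_roots'.1 hz).2)
  exact ⟨x, rfl⟩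

theorem RootsInInterval.mem {p : ℝ[X]} (hp : RootsInInterval p) {x : ℝ} (hx : p.eval x = 0) :
    -1 ≤ x ∧ x ≤ 0 := by
  obtain ⟨y, h1, h2, h3⟩ := hp x (by
    rw [← Complex.coe_algebraMap, aeval_algebraMap_apply, coe_aeval_eq_eval, hx, map_zero])
  rw [Complex.ofReal_inj] at h3
  exact h3 ▸ ⟨h1, h2⟩

/-- Seen from a point off the segment, all the inverses lie in one open half-plane, as in the
Gauss–Lucas theorem: the sign of the imaginary part is constant if `z` is not real, that of the real
part otherwise. -/
theorem exists_linear_pos_inv {z : ℂ} (hz : ¬ ∃ x : ℝ, -1 ≤ x ∧ x ≤ 0 ∧ z = x) :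
    ∃ l : ℂ →ₗ[ℝ] ℝ, ∀ r : ℝ, -1 ≤ r → r ≤ 0 → 0 < l (z - r)⁻¹ := by
  have hne : ∀ r : ℝ, -1 ≤ r → r ≤ 0 → 0 < Complex.normSq (z - r) := fun r h1 h2 =>
    Complex.normSq_pos.2 fun h => hz ⟨r, h1, h2, sub_eq_zero.1 h⟩
  by_cases him : z.im = 0
  · have hz' : z = (z.re : ℂ) := Complex.ext rfl (by simp [him])
    by_cases h0 : 0 < z.re
    · refine ⟨Complex.reLm, fun r h1 h2 => ?_⟩
      rw [Complex.reLm_coe, Complex.inv_re]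
      exact div_pos (by simp; linarith) (hne r h1 h2)
    · have h3 : z.re < -1 := by
        by_contra h
        exact hz ⟨z.re, not_lt.1 h, not_lt.1 h0, hz'⟩
      refine ⟨-Complex.reLm, fun r h1 h2 => ?_⟩
      rw [LinearMap.neg_apply, Complex.reLm_coe, Complex.inv_re, ← neg_div]
      exact div_pos (by simp; linarith) (hne r h1 h2)
  · refine ⟨-(z.im) • Complex.imLm, fun r h1 h2 => ?_⟩
    rw [LinearMap.smul_apply, Complex.imLm_coe, Complex.inv_im, smul_eq_mul, mul_div_assoc']
    refine div_pos ?_ (hne r h1 h2)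
    have : 0 < z.im * z.im := mul_self_pos.2 him
    simpa using this

theorem rootsInInterval_subdiv_step {R : ℝ[X]} (hR : RootsInInterval R) {r : ℝ} (h1 : -1 ≤ r)
    (h2 : r ≤ 0) :
    RootsInInterval (X * (1 + X) * derivative R + (X - C r) * R) := by
  intro z hz
  by_contra hcon
  obtain ⟨l, hl⟩ := exists_linear_pos_inv hcon
  have hz0 : z ≠ 0 := fun h => hcon ⟨0, by norm_num, le_rfl, by simpa using h⟩
  have hz1 : 1 + z ≠ 0 := fun h => hcon ⟨-1, le_rfl, by norm_num, by
    push_cast; linear_combination h⟩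
  have hRz : eval z (R.map (algebraMap ℝ ℂ)) ≠ 0 := fun h =>
    hcon (hR z (by rwa [aeval_def, ← eval_map]))
  have hS := (IsAlgClosed.splits (R.map (algebraMap ℝ ℂ))).eval_derivative_div_eval_of_ne_zero hRz
  rw [aeval_def, ← eval_map] at hz
  simp only [Polynomial.map_add, Polynomial.map_mul, Polynomial.map_sub, map_X, Polynomial.map_one,
    map_C, ← derivative_map, eval_add, eval_mul, eval_X, eval_sub, eval_one, eval_C] at hz
  set Q := R.map (algebraMap ℝ ℂ) with hQ
  -- Divide by `z(1 + z)R(z)` and use partial fractions. The weights `-r` and `1 + r` are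
  -- nonnegative with sum `1`, so `l` is positive on the left side.
  have key : (Q.roots.map fun a => 1 / (z - a)).sum + (-r) • (z - (0 : ℝ))⁻¹ +
      (1 + r) • (z - (-1 : ℝ))⁻¹ = 0 := by
    rw [← hS]
    simp only [Complex.real_smul, Complex.coe_algebraMap] at hz ⊢
    have e : z - ((-1 : ℝ) : ℂ) = 1 + z := by push_cast; ring
    rw [e]
    push_cast
    rw [sub_zero]
    field_simp
    linear_combination hz
  have := congrArg l key
  rw [map_add, map_add, map_smul, map_smul, map_zero, map_multiset_sum, Multiset.map_map] at this
  have hs : 0 ≤ (Q.roots.map (l ∘ fun a => 1 / (z - a))).sum := by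
    refine Multiset.sum_nonneg fun x hx => ?_
    obtain ⟨a, ha, rfl⟩ := Multiset.mem_map.1 hx
    obtain ⟨y, hy1, hy2, rfl⟩ := hR a (by rw [aeval_def, ← eval_map]; exact (mem_roots'.1 ha).2)
    have := hl y hy1 hy2
    simpa using this.le
  have p0 := hl 0 (by norm_num) le_rfl
  have p1 := hl (-1) le_rfl (by norm_num)
  simp only [smul_eq_mul] at this
  rcases eq_or_lt_of_le h2 with rfl | h3
  · nlinarith
  · nlinarith [mul_pos (neg_pos.2 h3) p0, mul_nonneg (by linarith : (0 : ℝ) ≤ 1 + r) p1.le]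

theorem Polynomial.Splits.eval_derivative_derivative_div_eval {R : ℝ[X]} (hR : R.Splits) {x : ℝ}
    (hx : R.eval x ≠ 0) :
    (derivative (derivative R)).eval x / R.eval x =
      ((derivative R).eval x / R.eval x) ^ 2 -
        (R.roots.map fun r => 1 / (x - r) ^ 2).sum := by
  have hne : ∀ r ∈ R.roots, x - r ≠ 0 := fun r hr h => hx (by
    rw [sub_eq_zero.1 h]; exact (mem_roots'.1 hr).2)
  have h1 : HasDerivAt (fun y => (derivative R).eval y / R.eval y)
      (((derivative (derivative R)).eval x * R.eval x -
        (derivative R).eval x * (derivative R).eval x) / (R.eval x) ^ 2) x :=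
    ((derivative R).hasDerivAt x).div (R.hasDerivAt x) hx
  have h2 : ∀ s : Multiset ℝ, (∀ r ∈ s, x - r ≠ 0) →
      HasDerivAt (fun y => (s.map fun r => 1 / (y - r)).sum)
        (-(s.map fun r => 1 / (x - r) ^ 2).sum) x := by
    intro s
    induction s using Multiset.induction_on with
    | empty => intro _; simpa using hasDerivAt_const x (0 : ℝ)
    | cons a s ih =>
      intro hs
      simp only [Multiset.map_cons, Multiset.sum_cons]
      have ha := ((hasDerivAt_id x).sub_const a).inv (hs a (Multiset.mem_cons_self a s))
      have := ha.add (ih fun r hr => hs r (Multiset.mem_cons_of_mem hr))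
      refine (this.congr_deriv ?_).congr_of_eventuallyEq ?_
      · simp only [id]; ring
      · exact Eventually.of_forall fun y => by simp
  have h3 : (fun y => (derivative R).eval y / R.eval y) =ᶠ[𝓝 x]
      fun y => (R.roots.map fun r => 1 / (y - r)).sum := by
    filter_upwards [R.continuous.continuousAt.eventually_ne hx] with y hy
    exact hR.eval_derivative_div_eval_of_ne_zero hy
  have h4 := h1.unique ((h2 R.roots hne).congr_of_eventuallyEq h3)
  rw [← neg_neg (Multiset.sum _), ← h4]
  field_simp
  ring

/-- A common root with `R` must be `0` or `-1`, where the derivative is `(1 - r)R'` or `-(2 + r)R'`.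
Elsewhere the quotient by `R` is `x(1 + x)R'/R + (x - r)`, whose derivative is at least `1`. -/
theorem eval_derivative_subdiv_step_ne_zero {R : ℝ[X]} (hR : RootsInInterval R)
    (hsimple : ∀ x : ℝ, R.eval x = 0 → (derivative R).eval x ≠ 0) {r : ℝ} (h1 : -1 ≤ r)
    (h2 : r ≤ 0) {x : ℝ}
    (hx : (X * (1 + X) * derivative R + (X - C r) * R).eval x = 0) :
    (derivative (X * (1 + X) * derivative R + (X - C r) * R)).eval x ≠ 0 := by
  simp only [derivative_add, derivative_mul, derivative_sub, derivative_X, derivative_one,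
    derivative_C, eval_add, eval_mul, eval_sub, eval_X, eval_one, eval_C, eval_zero] at hx ⊢
  by_cases hRx : R.eval x = 0
  · have hd := hsimple x hRx
    rw [hRx] at hx ⊢
    have : x * (1 + x) = 0 := by
      rcases mul_eq_zero.1 (by linarith : x * (1 + x) * (derivative R).eval x = 0) with h | h
      · exact h
      · exact absurd h hd
    intro h
    rcases mul_eq_zero.1 this with rfl | h0
    · have : (1 - r) * (derivative R).eval 0 = 0 := by linarith
      rcases mul_eq_zero.1 this with h | h
      · linarith
      · exact hd h
    · obtain rfl : x = -1 := by linarith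
      have : (2 + r) * (derivative R).eval (-1) = 0 := by linarith
      rcases mul_eq_zero.1 this with h | h
      · linarith
      · exact hd h
  · have hS := hR.splits.eval_derivative_div_eval_of_ne_zero hRx
    have hS2 := hR.splits.eval_derivative_derivative_div_eval hRx
    set A := (derivative R).eval x / R.eval x with hA
    set B := (derivative (derivative R)).eval x / R.eval x with hB
    have hA' : (derivative R).eval x = A * R.eval x := by rw [hA]; field_simp
    have hB' : (derivative (derivative R)).eval x = B * R.eval x := by rw [hB]; field_simp
    rw [hA'] at hx
    rw [hA', hB']
    have hx' : x * (1 + x) * A + (x - r) = 0 := by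
      have : (x * (1 + x) * A + (x - r)) * R.eval x = 0 := by linarith
      exact (mul_eq_zero.1 this).resolve_right hRx
    -- This is the derivative of `x(1 + x)R'/R`; a root `s` of `R` contributes `1 - s(1 + s)/(x -
    -- s)²`.
    have hpos : 0 ≤ (1 + 2 * x) * A - x * (1 + x) * (A ^ 2 - B) := by
      have : (1 + 2 * x) * A - x * (1 + x) * (A ^ 2 - B) =
          (R.roots.map fun s => (1 + 2 * x) * (1 / (x - s)) -
            x * (1 + x) * (1 / (x - s) ^ 2)).sum := by
        rw [Multiset.sum_map_sub, Multiset.sum_map_mul_left, Multiset.sum_map_mul_left, ← hS, hS2]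
        ring
      rw [this]
      refine Multiset.sum_nonneg fun y hy => ?_
      obtain ⟨s, hs, rfl⟩ := Multiset.mem_map.1 hy
      have hs0 : R.eval s = 0 := (mem_roots'.1 hs).2
      obtain ⟨hs1, hs2⟩ := hR.mem hs0
      have hxs : x - s ≠ 0 := fun h => hRx (by rw [sub_eq_zero.1 h, hs0])
      have : (1 + 2 * x) * (1 / (x - s)) - x * (1 + x) * (1 / (x - s) ^ 2) =
          ((x - s) ^ 2 + (-s) * (1 + s)) / (x - s) ^ 2 := by
        field_simp
        ring
      rw [this]
      have : 0 ≤ (-s) * (1 + s) := mul_nonneg (by linarith) (by linarith)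
      positivity
    intro h
    have h3 : (1 + 2 * x) * A + x * (1 + x) * B + 1 + (x - r) * A = 0 := by
      have : ((1 + 2 * x) * A + x * (1 + x) * B + 1 + (x - r) * A) * R.eval x = 0 := by linarith
      exact (mul_eq_zero.1 this).resolve_right hRx
    have h4 : x - r = -(x * (1 + x) * A) := by linarith
    rw [h4] at h3
    nlinarith

/-- `subdivOp` maps polynomials all of whose roots lie in `[-1, 0]` to such polynomials with simple
roots. -/
theorem rootsInInterval_subdivOp {p : ℝ[X]} (hp : RootsInInterval p) :
    RootsInInterval (subdivOp p) ∧
      ∀ x : ℝ, (subdivOp p).eval x = 0 → (derivative (subdivOp p)).eval x ≠ 0 := by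
  have key : ∀ (s : Multiset ℝ) (a : ℝ), a ≠ 0 → (∀ r ∈ s, -1 ≤ r ∧ r ≤ 0) →
      RootsInInterval (subdivOp ((s.map fun r => X - C r).prod * C a)) ∧
      ∀ x : ℝ, (subdivOp ((s.map fun r => X - C r).prod * C a)).eval x = 0 →
        (derivative (subdivOp ((s.map fun r => X - C r).prod * C a))).eval x ≠ 0 := by
    intro s a ha
    induction s using Multiset.induction_on with
    | empty =>
      intro _
      simp only [Multiset.map_zero, Multiset.prod_zero, one_mul, subdivOp_C]
      exact ⟨fun z hz => absurd (by simpa using hz) ha, fun x hx => absurd (by simpa using hx) ha⟩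
    | cons r s ih =>
      intro hs
      obtain ⟨h1, h2⟩ := hs r (Multiset.mem_cons_self r s)
      obtain ⟨ih1, ih2⟩ := ih fun r hr => hs r (Multiset.mem_cons_of_mem hr)
      rw [Multiset.map_cons, Multiset.prod_cons, mul_assoc, subdivOp_X_sub_C_mul]
      exact ⟨rootsInInterval_subdiv_step ih1 h1 h2,
        fun x => eval_derivative_subdiv_step_ne_zero ih1 ih2 h1 h2⟩
  have := key p.roots p.leadingCoeff (leadingCoeff_ne_zero.2 hp.ne_zero) fun r hr =>
    hp.mem (mem_roots'.1 hr).2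
  rwa [mul_comm, ← hp.splits.eq_prod_roots] at this

/-! ### The dominant eigenvector and convergence of the iterates -/

theorem factorial_lt_factorial_of_two_le {i d : ℕ} (hd : 2 ≤ d) (hi : i < d) :
    i.factorial < d.factorial := by
  rcases Nat.eq_zero_or_pos i with rfl | h
  · exact Nat.lt_of_lt_of_le one_lt_two (Nat.factorial_le hd)
  · exact (Nat.factorial_lt h).2 hi

/-- A monic eigenvector of `subdivOp` of degree `d` and eigenvalue `d!`. -/
def IsFactorialEigen (d : ℕ) (q : ℝ[X]) : Prop :=
  q.Monic ∧ q.natDegree = d ∧ subdivOp q = (d.factorial : ℝ) • q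

/-- In degrees below `d`, `subdivOp - d!` is triangular with nonzero diagonal `i! - d!`, hence
bijective. It also maps `X ^ d` into these degrees, so a lower-order correction of `X ^ d` lies in
its kernel. -/
theorem exists_isFactorialEigen {d : ℕ} (hd : 2 ≤ d) : ∃ q, IsFactorialEigen d q := by
  let g : ℝ[X] →ₗ[ℝ] ℝ[X] := subdivOp - (d.factorial : ℝ) • LinearMap.id
  have hgapp : ∀ p, g p = subdivOp p - (d.factorial : ℝ) • p := fun p => rfl
  have hdeg : ∀ p : ℝ[X], p.natDegree < d → g p ∈ degreeLT ℝ d := fun p hp => by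
    rw [mem_degreeLT, hgapp]
    refine (degree_le_natDegree).trans_lt (Nat.cast_lt.2 ?_)
    refine (natDegree_sub_le _ _).trans_lt (max_lt ?_ ?_)
    · exact (natDegree_subdivOp_le p).trans_lt hp
    · exact (natDegree_smul_le _ _).trans_lt hp
  have hnat : ∀ p ∈ degreeLT ℝ d, p.natDegree < d := fun p hp => by
    rcases eq_or_ne p 0 with rfl | h
    · simp; omega
    · exact (natDegree_lt_iff_degree_lt h).2 (mem_degreeLT.1 hp)
  let f : degreeLT ℝ d →ₗ[ℝ] degreeLT ℝ d := g.restrict fun p hp => hdeg p (hnat p hp)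
  have hf : Function.Injective f := by
    rw [← LinearMap.ker_eq_bot, LinearMap.ker_eq_bot']
    rintro ⟨p, hp⟩ hfp
    have h0 : subdivOp p - (d.factorial : ℝ) • p = 0 := congrArg Subtype.val hfp
    have hpd := hnat p hp
    have h1 := congrArg (fun r => r.coeff p.natDegree) h0
    simp only [coeff_sub, coeff_smul, coeff_zero, smul_eq_mul,
      coeff_subdivOp_of_natDegree_le le_rfl, ← sub_mul] at h1
    have h2 : (p.natDegree.factorial : ℝ) < d.factorial := by
      exact_mod_cast factorial_lt_factorial_of_two_le hd hpd
    have h3 := (mul_eq_zero.1 h1).resolve_left (sub_ne_zero.2 h2.ne)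
    exact Subtype.ext (leadingCoeff_eq_zero.1 h3)
  have hX : g (X ^ d) ∈ degreeLT ℝ d := by
    rw [mem_degreeLT, hgapp, degree_lt_iff_coeff_zero]
    intro m hm
    rw [coeff_sub, coeff_smul, coeff_X_pow]
    rcases eq_or_lt_of_le hm with rfl | hlt
    · rw [coeff_subdivOp_of_natDegree_le (natDegree_X_pow d).le]
      simp
    · rw [coeff_eq_zero_of_natDegree_lt]
      · simp [hlt.ne']
      · exact (natDegree_subdivOp_le _).trans_lt (by simpa using hlt)
  obtain ⟨s, hs⟩ := (LinearMap.injective_iff_surjective.1 hf) ⟨g (X ^ d), hX⟩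
  have hs' : g s = g (X ^ d) := congrArg Subtype.val hs
  have hsd : s.1.degree < d := mem_degreeLT.1 s.2
  refine ⟨X ^ d - s.1, ?_, ?_, ?_⟩
  · exact monic_X_pow_sub hsd
  · rw [natDegree_sub_eq_left_of_natDegree_lt, natDegree_X_pow]
    rw [natDegree_X_pow]
    exact hnat _ s.2
  · have := map_sub g (X ^ d) s.1
    rw [hs', sub_self, hgapp, sub_eq_zero] at this
    exact this

section

variable {A : Type*} [NormedField A] [NormedAlgebra ℝ A]

theorem IsFactorialEigen.pow_apply {d : ℕ} {q : ℝ[X]} (hq : IsFactorialEigen d q) (n : ℕ) :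
    (subdivOp ^ n) q = ((d.factorial : ℝ) ^ n) • q := by
  induction n with
  | zero => simp
  | succ n ih => rw [pow_succ, Module.End.mul_apply, hq.2.2, map_smul, ih, smul_smul, pow_succ']

theorem IsFactorialEigen.scaled_aeval {d : ℕ} {q : ℝ[X]} (hq : IsFactorialEigen d q) (p : ℝ[X])
    (z : A) (n : ℕ) :
    ((d.factorial : ℝ) ^ n)⁻¹ • aeval z ((subdivOp ^ n) p) = p.coeff d • aeval z q +
      ((d.factorial : ℝ) ^ n)⁻¹ • aeval z ((subdivOp ^ n) (p - p.coeff d • q)) := by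
  have h : ((d.factorial : ℝ) ^ n) ≠ 0 := by positivity
  rw [map_sub, map_smul, hq.pow_apply, map_sub, smul_sub, map_smul, map_smul, smul_comm (p.coeff d),
    smul_smul _ ((d.factorial : ℝ) ^ n), inv_mul_cancel₀ h, one_smul, add_sub_cancel]

theorem IsFactorialEigen.natDegree_sub_lt {d : ℕ} (hd : 0 < d) {q : ℝ[X]}
    (hq : IsFactorialEigen d q) {p : ℝ[X]} (hp : p.natDegree ≤ d) :
    (p - p.coeff d • q).natDegree < d := by
  refine lt_of_le_of_ne ?_ fun h => ?_
  · exact (natDegree_sub_le _ _).trans (max_le hp ((natDegree_smul_le _ _).trans hq.2.1.le))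
  · have h0 : (p - p.coeff d • q).coeff d = 0 := by
      have := hq.1.coeff_natDegree
      rw [hq.2.1] at this
      rw [coeff_sub, coeff_smul, this]
      simp
    have h1 : (p - p.coeff d • q).leadingCoeff = 0 := by rw [leadingCoeff, h, h0]
    rw [leadingCoeff_eq_zero.1 h1, natDegree_zero] at h
    omega

/-- By induction, the iterates scaled by `(d!)ⁿ` converge in degree at most `d`; the extra factor
`(d + 1)⁻ⁿ` then gives limit `0`. In the base case the operator fixes `1` and `X`. -/
theorem tendsto_scaled_aeval_of_natDegree_lt {d : ℕ} (hd : 2 ≤ d) (z : A) :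
    ∀ p : ℝ[X], p.natDegree < d →
      Tendsto (fun n : ℕ => ((d.factorial : ℝ) ^ n)⁻¹ • aeval z ((subdivOp ^ n) p))
        atTop (𝓝 0) := by
  induction d, hd using Nat.le_induction with
  | base =>
    intro p hp
    have hT : subdivOp p = p := by
      rw [eq_X_add_C_of_natDegree_le_one (Nat.le_of_lt_succ hp), map_add, subdivOp_C,
        ← smul_eq_C_mul, map_smul, subdivOp_X]
    have hTn : ∀ n : ℕ, (subdivOp ^ n) p = p := fun n => by
      induction n with
      | zero => simp
      | succ n ih => rw [pow_succ, Module.End.mul_apply, hT, ih]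
    simp only [hTn, ← inv_pow]
    have := (tendsto_pow_atTop_nhds_zero_of_lt_one (r := ((Nat.factorial 2 : ℕ) : ℝ)⁻¹)
      (by positivity) (by norm_num)).smul_const (aeval z p)
    rwa [zero_smul] at this
  | succ d hd ih =>
    intro p hp
    obtain ⟨q, hq⟩ := exists_isFactorialEigen hd
    have h1 := (ih _ (hq.natDegree_sub_lt (by omega) (Nat.le_of_lt_succ hp))).const_add
      (p.coeff d • aeval z q)
    simp only [← hq.scaled_aeval] at h1
    have h2 := (tendsto_pow_atTop_nhds_zero_of_lt_one (r := ((d + 1 : ℕ) : ℝ)⁻¹)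
      (by positivity) (inv_lt_one_of_one_lt₀ (by exact_mod_cast (by omega)))).smul h1
    rw [zero_smul] at h2
    refine h2.congr fun n => ?_
    rw [smul_smul, inv_pow, Nat.factorial_succ, Nat.cast_mul, mul_pow, mul_inv]

theorem IsFactorialEigen.tendsto_scaled_aeval {d : ℕ} (hd : 2 ≤ d) {q : ℝ[X]}
    (hq : IsFactorialEigen d q) {p : ℝ[X]} (hp : p.natDegree ≤ d) (z : A) :
    Tendsto (fun n : ℕ => ((d.factorial : ℝ) ^ n)⁻¹ • aeval z ((subdivOp ^ n) p))
      atTop (𝓝 (p.coeff d • aeval z q)) := by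
  have h1 := (tendsto_scaled_aeval_of_natDegree_lt hd z _
    (hq.natDegree_sub_lt (by omega) hp)).const_add (p.coeff d • aeval z q)
  simpa only [← hq.scaled_aeval, add_zero] using h1

end

/-! ### Roots of the eigenvector -/

theorem natDegree_subdivOp_pow_le (n : ℕ) (p : ℝ[X]) :
    ((subdivOp ^ n) p).natDegree ≤ p.natDegree := by
  induction n with
  | zero => simp
  | succ n ih =>
    rw [pow_succ', Module.End.mul_apply]
    exact (natDegree_subdivOp_le _).trans ih

theorem coeff_subdivOp_pow {p : ℝ[X]} {d : ℕ} (hp : p.natDegree ≤ d) (n : ℕ) :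
    ((subdivOp ^ n) p).coeff d = (d.factorial : ℝ) ^ n * p.coeff d := by
  induction n with
  | zero => simp
  | succ n ih =>
    rw [pow_succ', Module.End.mul_apply,
      coeff_subdivOp_of_natDegree_le ((natDegree_subdivOp_pow_le n p).trans hp), ih]
    ring

theorem rootsInInterval_X_pow (d : ℕ) : RootsInInterval (X ^ d) := fun z hz => by
  rw [map_pow, aeval_X] at hz
  exact ⟨0, by norm_num, le_rfl, by simpa using eq_zero_of_pow_eq_zero hz⟩

theorem rootsInInterval_subdivOp_pow (n : ℕ) {p : ℝ[X]} (hp : RootsInInterval p) :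
    RootsInInterval ((subdivOp ^ n) p) := by
  induction n with
  | zero => simpa using hp
  | succ n ih =>
    rw [pow_succ', Module.End.mul_apply]
    exact (rootsInInterval_subdivOp ih).1

theorem RootsInInterval.pow_le_norm_aeval {p : ℝ[X]} (hp : RootsInInterval p) {z : ℂ} {δ : ℝ}
    (hδ : 0 ≤ δ) (hz : ∀ x : ℝ, -1 ≤ x → x ≤ 0 → δ ≤ ‖z - x‖) :
    |p.leadingCoeff| * δ ^ p.natDegree ≤ ‖aeval z p‖ := by
  have hs := hp.splits
  have key : ∀ s : Multiset ℝ, (∀ r ∈ s, -1 ≤ r ∧ r ≤ 0) →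
      δ ^ s.card ≤ ‖aeval z (s.map fun r => X - C r).prod‖ := by
    intro s
    induction s using Multiset.induction_on with
    | empty => intro _; simp
    | cons a s ih =>
      intro hs
      obtain ⟨h1, h2⟩ := hs a (Multiset.mem_cons_self a s)
      rw [Multiset.card_cons, Multiset.map_cons, Multiset.prod_cons, map_mul, norm_mul, pow_succ']
      refine mul_le_mul ?_ (ih fun r hr => hs r (Multiset.mem_cons_of_mem hr)) (by positivity)
        (norm_nonneg _)
      simpa using hz a h1 h2
  have h := key p.roots fun r hr => hp.mem (mem_roots'.1 hr).2
  rw [← hs.natDegree_eq_card_roots] at h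
  conv_rhs => rw [hs.eq_prod_roots, map_mul, norm_mul]
  refine mul_le_mul ?_ h (by positivity) (norm_nonneg _)
  simp

/-- The scaled iterates of `X ^ d` are monic with roots in `[-1, 0]`. At distance `δ > 0` from the
segment they are bounded below by `δ ^ d`, and so is their limit `q`. -/
theorem IsFactorialEigen.rootsInInterval {d : ℕ} (hd : 2 ≤ d) {q : ℝ[X]}
    (hq : IsFactorialEigen d q) : RootsInInterval q := by
  intro z hz
  by_contra hcon
  obtain ⟨x, ⟨hx1, hx2⟩, hx⟩ := isCompact_Icc.exists_isMinOn (s := Set.Icc (-1 : ℝ) 0)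
    ⟨0, by norm_num, le_rfl⟩ (f := fun x : ℝ => ‖z - x‖) (by fun_prop)
  have hpos : 0 < ‖z - x‖ := norm_pos_iff.2 fun h => hcon ⟨x, hx1, hx2, sub_eq_zero.1 h⟩
  have h1 := (hq.tendsto_scaled_aeval hd (natDegree_X_pow d).le z).norm
  rw [hz, smul_zero, norm_zero] at h1
  have h2 : ∀ n : ℕ, ‖z - x‖ ^ d ≤
      ‖((d.factorial : ℝ) ^ n)⁻¹ • aeval z ((subdivOp ^ n) (X ^ d))‖ := fun n => by
    have hc := coeff_subdivOp_pow (natDegree_X_pow (R := ℝ) d).le n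
    rw [coeff_X_pow_self, mul_one] at hc
    have hle := (natDegree_subdivOp_pow_le n (X ^ d)).trans (natDegree_X_pow (R := ℝ) d).le
    have hdeg : ((subdivOp ^ n) (X ^ d)).natDegree = d :=
      le_antisymm hle (le_natDegree_of_ne_zero (by rw [hc]; positivity))
    have := (rootsInInterval_subdivOp_pow n (rootsInInterval_X_pow d)).pow_le_norm_aeval
      hpos.le fun y h1 h2 => hx ⟨h1, h2⟩
    rw [leadingCoeff, hdeg, hc, abs_of_pos (by positivity)] at this
    rw [norm_smul, norm_inv, Real.norm_of_nonneg (by positivity), inv_mul_eq_div,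
      le_div_iff₀ (by positivity), mul_comm]
    exact this
  exact absurd (ge_of_tendsto' h1 h2) (not_le.2 (by positivity))

theorem IsFactorialEigen.simple_roots {d : ℕ} (hd : 2 ≤ d) {q : ℝ[X]}
    (hq : IsFactorialEigen d q) {x : ℝ} (hx : q.eval x = 0) : (derivative q).eval x ≠ 0 := by
  have h := (rootsInInterval_subdivOp (hq.rootsInInterval hd)).2 x
  rw [hq.2.2, derivative_smul, eval_smul, eval_smul, hx, smul_zero] at h
  exact right_ne_zero_of_smul (h rfl)

theorem IsFactorialEigen.eval_zero {d : ℕ} (hd : 2 ≤ d) {q : ℝ[X]}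
    (hq : IsFactorialEigen d q) : q.eval 0 = 0 := by
  have h := coeff_zero_subdivOp q
  rw [hq.2.2, coeff_smul, coeff_zero_eq_eval_zero, smul_eq_mul] at h
  have : (1 : ℝ) < d.factorial := by
    exact_mod_cast factorial_lt_factorial_of_two_le (i := 0) hd (by omega)
  nlinarith [mul_eq_zero.1 (by linarith : ((d.factorial : ℝ) - 1) * q.eval 0 = 0)]

theorem IsFactorialEigen.eval_neg_one {d : ℕ} (hd : 2 ≤ d) {q : ℝ[X]}
    (hq : IsFactorialEigen d q) : q.eval (-1) = 0 := by
  have h := eval_neg_one_subdivOp q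
  rw [hq.2.2, eval_smul, smul_eq_mul] at h
  have : (1 : ℝ) < d.factorial := by
    exact_mod_cast factorial_lt_factorial_of_two_le (i := 0) hd (by omega)
  exact (mul_eq_zero.1 (by linarith : ((d.factorial : ℝ) - 1) * q.eval (-1) = 0)).resolve_left
    (by linarith)

/-- The nonzero roots of the eigenvector, transported to roots of the `h`-polynomial. -/
theorem IsFactorialEigen.exists_roots {e : ℕ} {q : ℝ[X]} (hq : IsFactorialEigen (e + 2) q) :
    ∃ x : Fin e → ℝ, Function.Injective x ∧ ∀ i, q.eval (x i) = 0 ∧ -1 < x i ∧ x i < 0 := by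
  have hd : 2 ≤ e + 2 := by omega
  have hR := hq.rootsInInterval hd
  have hnd : q.roots.Nodup := by
    rw [Multiset.nodup_iff_count_le_one]
    intro a
    rw [count_roots]
    by_contra h
    have h' := (one_lt_rootMultiplicity_iff_isRoot hR.ne_zero).1 (not_le.1 h)
    exact hq.simple_roots hd h'.1 h'.2
  have hmem : ∀ {a : ℝ}, a ∈ q.roots.toFinset ↔ q.eval a = 0 := fun {a} => by
    rw [Multiset.mem_toFinset, mem_roots hR.ne_zero, IsRoot.def]
  have hcard : ((q.roots.toFinset.erase 0).erase (-1)).card = e := by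
    rw [Finset.card_erase_of_mem, Finset.card_erase_of_mem (hmem.2 (hq.eval_zero hd)),
      Multiset.toFinset_card_of_nodup hnd, ← hR.splits.natDegree_eq_card_roots, hq.2.1]
    · rfl
    · exact Finset.mem_erase.2 ⟨by norm_num, hmem.2 (hq.eval_neg_one hd)⟩
  refine ⟨fun i => ((q.roots.toFinset.erase 0).erase (-1)).orderEmbOfFin hcard i,
    fun i j h => (Finset.orderEmbOfFin _ hcard).injective h, fun i => ?_⟩
  have h := Finset.orderEmbOfFin_mem _ hcard i
  rw [Finset.mem_erase, Finset.mem_erase, hmem] at h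
  obtain ⟨h1, h2⟩ := hR.mem h.2.2
  exact ⟨h.2.2, lt_of_le_of_ne h1 (Ne.symm h.1), lt_of_le_of_ne h2 h.2.1⟩

/-! ### Persistence of simple roots -/

/-- The real roots of polynomials `p n` near a simple root of their limit. -/
theorem exists_tendsto_roots {p : ℕ → ℝ[X]} {c : ℕ → ℝ} {q : ℝ[X]}
    (hlim : ∀ x : ℝ, Tendsto (fun n => c n * (p n).eval x) atTop (𝓝 (q.eval x))) (hc : ∀ n, c n ≠ 0)
    {x₀ : ℝ} (hx : q.eval x₀ = 0) (hx' : (derivative q).eval x₀ ≠ 0) :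
    ∃ y : ℕ → ℝ, Tendsto y atTop (𝓝 x₀) ∧ ∀ᶠ n in atTop, (p n).eval (y n) = 0 := by
  obtain ⟨g, hg⟩ := dvd_iff_isRoot.2 hx
  have hg0 : g.eval x₀ ≠ 0 := by
    rw [hg, derivative_mul] at hx'
    simpa using hx'
  have hgpos : ∀ᶠ x in 𝓝 x₀, 0 < g.eval x * g.eval x₀ := by
    have : ContinuousAt (fun x => g.eval x * g.eval x₀) x₀ := by fun_prop
    exact this.eventually (lt_mem_nhds (mul_self_pos.2 hg0))
  obtain ⟨ε₀, hε₀, hball⟩ := Metric.eventually_nhds_iff.1 hgpos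
  have hroot : ∀ ε, 0 < ε → ∀ᶠ n in atTop, ∃ y, dist y x₀ ≤ ε ∧ (p n).eval y = 0 := by
    intro ε hε
    obtain ⟨δ, hδ0, hδε, hδ1⟩ : ∃ δ, 0 < δ ∧ δ ≤ ε ∧ δ < ε₀ :=
      ⟨min ε (ε₀ / 2), by positivity, min_le_left _ _, (min_le_right _ _).trans_lt (by linarith)⟩
    have ha := hball (y := x₀ - δ) (by rw [Real.dist_eq, abs_lt]; constructor <;> linarith)
    have hb := hball (y := x₀ + δ) (by rw [Real.dist_eq, abs_lt]; constructor <;> linarith)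
    have hneg : q.eval (x₀ - δ) * q.eval (x₀ + δ) < 0 := by
      rw [hg]
      simp only [eval_mul, eval_sub, eval_X, eval_C]
      have h1 := mul_pos ha hb
      have h2 : 0 < g.eval (x₀ - δ) * g.eval (x₀ + δ) := by
        have : 0 < g.eval x₀ * g.eval x₀ := mul_self_pos.2 hg0
        by_contra h
        nlinarith [mul_nonneg (sub_nonneg.2 (not_lt.1 h)) this.le]
      nlinarith [mul_pos (mul_pos hδ0 hδ0) h2]
    filter_upwards [((hlim (x₀ - δ)).mul (hlim (x₀ + δ))).eventually (gt_mem_nhds hneg)] with n hn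
    have hn' : (p n).eval (x₀ - δ) * (p n).eval (x₀ + δ) < 0 := by
      have : 0 < c n * c n := mul_self_pos.2 (hc n)
      by_contra h
      nlinarith [mul_nonneg this.le (not_lt.1 h)]
    have hcont : ContinuousOn (fun x => (p n).eval x) (Set.uIcc (x₀ - δ) (x₀ + δ)) := by fun_prop
    have h0 : (0 : ℝ) ∈ Set.uIcc ((p n).eval (x₀ - δ)) ((p n).eval (x₀ + δ)) := by
      rw [Set.mem_uIcc]
      rcases mul_neg_iff.1 hn' with h | h
      · exact Or.inr ⟨h.2.le, h.1.le⟩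
      · exact Or.inl ⟨h.1.le, h.2.le⟩
    obtain ⟨y, hy, hy0⟩ := intermediate_value_uIcc hcont h0
    rw [Set.uIcc_of_le (by linarith)] at hy
    refine ⟨y, ?_, hy0⟩
    rw [Real.dist_eq, abs_le]
    constructor <;> linarith [hy.1, hy.2]
  -- Taking the root nearest to `x₀` gives one sequence that works for every `ε`.
  have hnear : ∀ n, ∃ y, (∃ z, (p n).eval z = 0) →
      (p n).eval y = 0 ∧ ∀ z, (p n).eval z = 0 → dist y x₀ ≤ dist z x₀ := by
    intro n
    by_cases h : ∃ z, (p n).eval z = 0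
    · have hcl : IsClosed {z | (p n).eval z = 0} :=
        isClosed_eq (p n).continuous continuous_const
      obtain ⟨y, hy, hyd⟩ := hcl.exists_infDist_eq_dist h x₀
      refine ⟨y, fun _ => ⟨hy, fun z hz => ?_⟩⟩
      rw [dist_comm, ← hyd, dist_comm]
      exact Metric.infDist_le_dist_of_mem hz
    · exact ⟨0, fun h' => absurd h' h⟩
  choose y hy using hnear
  refine ⟨y, ?_, ?_⟩
  · rw [Metric.tendsto_nhds]
    intro ε hε
    filter_upwards [hroot (ε / 2) (by positivity)] with n ⟨z, hz, hz0⟩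
    exact (((hy n ⟨z, hz0⟩).2 z hz0).trans hz).trans_lt (by linarith)
  · filter_upwards [hroot 1 one_pos] with n ⟨z, _, hz0⟩
    exact (hy n ⟨z, hz0⟩).1

/-! ### Ordered set partitions and chains -/

theorem sum_choose_succ_smul_fubiniPoly (k : ℕ) :
    ∑ l ∈ Finset.range (k + 2), (k + 1).choose l • fubiniPoly l =
      ∑ l ∈ Finset.range (k + 1), k.choose l • fubiniPoly l +
        ∑ l ∈ Finset.range (k + 1), k.choose l • fubiniPoly (l + 1) := by
  rw [Finset.sum_range_succ']
  simp only [Nat.choose_succ_succ, add_smul, Finset.sum_add_distrib]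
  rw [Finset.sum_range_succ (fun l => k.choose (l + 1) • fubiniPoly (l + 1)),
    Finset.sum_range_succ' (fun l => k.choose l • fubiniPoly l)]
  simp [Nat.choose_succ_self]
  ring

theorem X_mul_sum_choose_smul_fubiniPoly (k : ℕ) :
    X * ∑ l ∈ Finset.range (k + 1), k.choose l • fubiniPoly l =
      (1 + X) * fubiniPoly k - if k = 0 then 1 else 0 := by
  induction k with
  | zero => simp [fubiniPoly]
  | succ k ih =>
    rw [sum_choose_succ_smul_fubiniPoly]
    set D := ∑ l ∈ Finset.range (k + 1), k.choose l • fubiniPoly l with hD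
    have h1 : ∑ l ∈ Finset.range (k + 1), k.choose l • fubiniPoly (l + 1) =
        X * derivative ((1 + X) * D) := by
      rw [hD, Finset.mul_sum, derivative_sum, Finset.mul_sum]
      refine Finset.sum_congr rfl fun l _ => ?_
      rw [fubiniPoly, mul_smul_comm, derivative_smul, mul_smul_comm]
    -- The correction term for `k = 0` is constant, so differentiation removes it.
    have h2 : fubiniPoly (k + 1) = X * derivative (X * D) := by
      rw [ih, fubiniPoly, derivative_sub]
      split_ifs <;> simp
    rw [h1, h2, if_neg k.succ_ne_zero]
    simp only [derivative_mul, derivative_add, derivative_one, derivative_X]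
    ring

/-- Remove the last block of an ordered partition: the other blocks partition a proper subset of
size `l`. Chains below a cell satisfy the same recursion. -/
theorem X_mul_sum_range_choose_smul_fubiniPoly {k : ℕ} (hk : k ≠ 0) :
    X * ∑ l ∈ Finset.range k, k.choose l • fubiniPoly l = fubiniPoly k := by
  have h := X_mul_sum_choose_smul_fubiniPoly k
  rw [if_neg hk, Finset.sum_range_succ, Nat.choose_self, one_smul] at h
  linear_combination h

section Chains

variable {α : Type*} [PartialOrder α]

open Classical in
/-- The chains contained in `P`, counted by cardinality. -/
noncomputable def chainPoly (P : Finset α) : ℝ[X] :=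
  ∑ s ∈ P.powerset.filter (fun s : Finset α => IsChain (· ≤ ·) (s : Set α)), X ^ s.card

open Classical in
/-- Splitting off the top element of a nonempty chain. -/
theorem chainPoly_eq (P : Finset α) :
    chainPoly P = 1 + ∑ A ∈ P, X * chainPoly (P.filter (· < A)) := by
  have hempty : (∅ : Finset α) ∈
      P.powerset.filter (fun s : Finset α => IsChain (· ≤ ·) (s : Set α)) := by
    simp
  rw [chainPoly, ← Finset.add_sum_erase _ _ hempty, Finset.card_empty, pow_zero]
  congr 1
  simp only [chainPoly, Finset.mul_sum]
  rw [Finset.sum_sigma']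
  symm
  have hlt : ∀ a ∈ P.sigma fun A => (P.filter (· < A)).powerset.filter
      (fun s : Finset α => IsChain (· ≤ ·) (s : Set α)), a.1 ∈ P ∧ (∀ b ∈ a.2, b ∈ P ∧ b < a.1) ∧
        IsChain (· ≤ ·) (a.2 : Set α) := fun a ha => by
    rw [Finset.mem_sigma, Finset.mem_filter, Finset.mem_powerset] at ha
    exact ⟨ha.1, fun b hb => Finset.mem_filter.1 (ha.2.1 hb), ha.2.2⟩
  refine Finset.sum_bij (fun a _ => insert a.1 a.2) ?_ ?_ ?_ ?_
  · intro a ha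
    obtain ⟨h1, h2, h3⟩ := hlt a ha
    rw [Finset.mem_erase, Finset.mem_filter, Finset.mem_powerset, Finset.coe_insert]
    refine ⟨Finset.insert_ne_empty _ _, Finset.insert_subset h1 fun b hb => (h2 b hb).1,
      h3.insert fun b hb _ => Or.inr (h2 b hb).2.le⟩
  · rintro ⟨A, s⟩ ha ⟨B, t⟩ hb hab
    obtain ⟨h1, h2, -⟩ := hlt _ ha
    obtain ⟨h1', h2', -⟩ := hlt _ hb
    dsimp only at hab h2 h2'
    have hAs : A ∉ s := fun h => lt_irrefl _ (h2 A h).2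
    have hBt : B ∉ t := fun h => lt_irrefl _ (h2' B h).2
    have hAB : A = B := by
      rcases Finset.mem_insert.1 (hab ▸ Finset.mem_insert_self A s : A ∈ insert B t) with h | h
      · exact h
      · rcases Finset.mem_insert.1 (hab ▸ Finset.mem_insert_self B t : B ∈ insert A s) with h' | h'
        · exact h'.symm
        · exact absurd (h2 _ h').2 (h2' _ h).2.asymm
    subst hAB
    have := congrArg (fun u => u.erase A) hab
    simp only [Finset.erase_insert hAs, Finset.erase_insert hBt] at this
    rw [this]
  · intro s hs
    rw [Finset.mem_erase, Finset.mem_filter, Finset.mem_powerset] at hs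
    obtain ⟨hne, hsP, hch⟩ := hs
    obtain ⟨A, hA, hmax⟩ := s.exists_maximal (Finset.nonempty_iff_ne_empty.2 hne)
    have hltA : ∀ b ∈ s, b ≠ A → b < A := fun b hb hbA => by
      rcases hch.total hb hA with h | h
      · exact lt_of_le_of_ne h hbA
      · exact absurd (le_antisymm (hmax hb h) h) hbA
    refine ⟨⟨A, s.erase A⟩, ?_, Finset.insert_erase hA⟩
    rw [Finset.mem_sigma, Finset.mem_filter, Finset.mem_powerset]
    refine ⟨hsP hA, fun b hb => Finset.mem_filter.2 ?_,
      hch.mono (Finset.coe_subset.2 (Finset.erase_subset A s))⟩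
    exact ⟨hsP (Finset.mem_of_mem_erase hb),
      hltA b (Finset.mem_of_mem_erase hb) (Finset.ne_of_mem_erase hb)⟩
  · intro a ha
    have : a.1 ∉ a.2 := fun h => lt_irrefl _ ((hlt a ha).2.1 _ h).2
    rw [Finset.card_insert_of_notMem this, pow_succ']

/-- Everything below `B` already lies in the Boolean interval, where erasing one element lowers the
height by exactly one. -/
theorem height_eq_card_of_orderIso {A : α} {k : ℕ} (e : Set.Iic A ≃o Finset (Fin k)) :
    ∀ (n : ℕ) (B : Set.Iic A), (e B).card = n → Order.height (B : α) = n := by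
  intro n
  induction n using Nat.strong_induction_on with
  | _ n ih =>
    intro B hB
    rw [Order.height_eq_iSup_lt_height]
    refine le_antisymm (iSup₂_le fun C hC => ?_) ?_
    · have hlt : e ⟨C, hC.le.trans B.2⟩ < e B := e.lt_iff_lt.2 hC
      have hcard := Finset.card_lt_card hlt
      rw [hB] at hcard
      rw [show Order.height C = _ from ih _ hcard ⟨C, hC.le.trans B.2⟩ rfl]
      exact_mod_cast hcard
    · rcases n with _ | n
      · simp
      · obtain ⟨i, hi⟩ := Finset.card_pos.1 (by rw [hB]; exact n.succ_pos : 0 < (e B).card)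
        have hcard : ((e B).erase i).card = n := by rw [Finset.card_erase_of_mem hi, hB]; rfl
        have hlt : e.symm ((e B).erase i) < B := by
          rw [← e.lt_iff_lt, e.apply_symm_apply]
          exact Finset.erase_ssubset hi
        refine le_iSup₂_of_le (e.symm ((e B).erase i) : α) hlt ?_
        rw [ih n n.lt_succ_self _ (by rw [e.apply_symm_apply, hcard])]
        simp

end Chains

/-! ### Rank polynomials under subdivision -/

namespace BooleanCellComplex

noncomputable instance (Δ : BooleanCellComplex.{u}) : Fintype Δ.Face := Fintype.ofFinite _

/-- The rank of a face, one more than its dimension. -/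
noncomputable def rank (Δ : BooleanCellComplex.{u}) (A : Δ.Face) : ℕ := (Order.height A).toNat

/-- The polynomial counting faces by rank. -/
noncomputable def rankPoly (Δ : BooleanCellComplex.{u}) : ℝ[X] := ∑ A : Δ.Face, X ^ Δ.rank A

variable (Δ : BooleanCellComplex.{u})

theorem exists_orderIso_rank (A : Δ.Face) :
    ∃ e : Set.Iic A ≃o Finset (Fin (Δ.rank A)), ∀ B : Set.Iic A, Δ.rank B = (e B).card := by
  obtain ⟨k, ⟨e⟩⟩ := Δ.boolean A
  have h : ∀ B : Set.Iic A, Δ.rank B = (e B).card := fun B => by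
    rw [rank, height_eq_card_of_orderIso e _ B rfl, ENat.toNat_natCast]
  have hA : Δ.rank A = k := by
    have htop : e ⟨A, le_rfl⟩ = Finset.univ := by
      refine top_le_iff.1 (e.symm.le_iff_le.1 ?_)
      rw [e.symm_apply_apply]
      exact (e.symm ⊤).2
    rw [h ⟨A, le_rfl⟩, htop, Finset.card_univ, Fintype.card_fin]
  subst hA
  exact ⟨e, h⟩

theorem natCard_Iic (A : Δ.Face) : Nat.card (Set.Iic A) = 2 ^ Δ.rank A := by
  obtain ⟨e, -⟩ := Δ.exists_orderIso_rank A
  rw [Nat.card_congr e.toEquiv]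
  simp

theorem rank_eq_zero {A : Δ.Face} : Δ.rank A = 0 ↔ A = ⊥ := by
  constructor
  · intro h
    have hc := Δ.natCard_Iic A
    rw [h, pow_zero, Nat.card_eq_one_iff_unique] at hc
    have := hc.1.elim ⟨A, le_rfl⟩ ⟨⊥, bot_le⟩
    exact congrArg Subtype.val this
  · rintro rfl
    rw [rank, Order.height_bot]
    rfl

open Classical in
theorem sum_filter_le_rank {M : Type*} [AddCommMonoid M] (F : ℕ → M) (A : Δ.Face) :
    ∑ B ∈ Finset.univ.filter (· ≤ A), F (Δ.rank B) =
      ∑ l ∈ Finset.range (Δ.rank A + 1), (Δ.rank A).choose l • F l := by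
  obtain ⟨e, he⟩ := Δ.exists_orderIso_rank A
  have h1 := Finset.sum_powerset_apply_card F (x := (Finset.univ : Finset (Fin (Δ.rank A))))
  rw [Finset.powerset_univ, Finset.card_univ, Fintype.card_fin] at h1
  rw [← h1]
  refine Finset.sum_bij' (fun B hB => e ⟨B, (Finset.mem_filter.1 hB).2⟩)
    (fun t _ => (e.symm t : Δ.Face)) ?_ ?_ ?_ ?_ ?_
  · intros; exact Finset.mem_univ _
  · intro t _
    exact Finset.mem_filter.2 ⟨Finset.mem_univ _, (e.symm t).2⟩
  · intro B hB
    exact congrArg Subtype.val (e.symm_apply_apply _)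
  · intro t _
    exact e.apply_symm_apply t
  · intro B hB
    rw [← he]

open Classical in
-- The chains counted are those with top cell `A`. Sorting them by the next cell below `A`, of which
-- `k.choose l` have rank `l`, gives the recursion of `fubiniPoly`.
theorem X_mul_chainPoly_lt : ∀ (k : ℕ) (A : Δ.Face), Δ.rank A = k → A ≠ ⊥ →
    X * chainPoly ((Finset.univ.erase (⊥ : Δ.Face)).filter (· < A)) = fubiniPoly k := by
  intro k
  induction k using Nat.strong_induction_on with
  | _ k ih =>
    intro A hk hA
    have hk0 : k ≠ 0 := fun h => hA (Δ.rank_eq_zero.1 (hk.trans h))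
    rw [chainPoly_eq, ← X_mul_sum_range_choose_smul_fubiniPoly hk0]
    congr 1
    have hsum := Δ.sum_filter_le_rank fubiniPoly A
    rw [hk, Finset.sum_range_succ, Nat.choose_self, one_smul] at hsum
    have hsplit : Finset.univ.filter (· ≤ A) =
        insert A (insert ⊥ ((Finset.univ.erase (⊥ : Δ.Face)).filter (· < A))) := by
      ext B
      simp only [Finset.mem_filter, Finset.mem_univ, true_and, Finset.mem_insert, Finset.mem_erase,
        and_true]
      constructor
      · intro h
        by_cases h1 : B = A
        · exact Or.inl h1
        · by_cases h2 : B = ⊥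
          · exact Or.inr (Or.inl h2)
          · exact Or.inr (Or.inr ⟨h2, lt_of_le_of_ne h h1⟩)
      · rintro (rfl | rfl | ⟨_, h⟩)
        · exact le_rfl
        · exact bot_le
        · exact h.le
    -- The term of `A` cancels against `l = k`; that of `⊥` is `fubiniPoly 0 = 1`, matching the
    -- empty chain below `A`.
    rw [hsplit, Finset.sum_insert (by simp [hA]), Finset.sum_insert (by simp), hk,
      Δ.rank_eq_zero.2 rfl, add_comm, add_left_inj] at hsum
    rw [← hsum]
    congr 1
    refine Finset.sum_congr rfl fun B hB => ?_
    rw [Finset.mem_filter, Finset.mem_erase] at hB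
    have hrank : Δ.rank B < k := by
      obtain ⟨e, he⟩ := Δ.exists_orderIso_rank A
      have hlt : (⟨B, hB.2.le⟩ : Set.Iic A) < ⟨A, le_rfl⟩ := hB.2
      have := Finset.card_lt_card (e.lt_iff_lt.2 hlt)
      rw [← he, ← he, hk] at this
      exact this
    rw [← ih _ hrank B rfl hB.1.1, Finset.filter_filter]
    congr 2
    refine Finset.filter_congr fun C _ => ?_
    exact ⟨fun h => h.2, fun h => ⟨h.trans hB.2, h⟩⟩

theorem rank_sd (s : Δ.Flag) : Δ.sd.rank s = s.1.card := by
  have h := Δ.sd.natCard_Iic s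
  have h2 : Nat.card (Set.Iic s : Set Δ.Flag) = 2 ^ s.1.card := by
    rw [← Finset.card_powerset, ← Nat.card_eq_finsetCard]
    refine Nat.card_congr ⟨fun t => ⟨t.1.1, Finset.mem_powerset.2 t.2⟩, fun t =>
      ⟨(⟨t.1, fun h => s.2.1 (Finset.mem_powerset.1 t.2 h),
        s.2.2.mono (Finset.coe_subset.2 (Finset.mem_powerset.1 t.2))⟩ : Δ.Flag),
        Finset.mem_powerset.1 t.2⟩, fun t => rfl, fun t => rfl⟩
  exact Nat.pow_right_injective le_rfl (h.symm.trans h2)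

theorem rankPoly_sd : Δ.sd.rankPoly = subdivOp Δ.rankPoly := by
  classical
  have h1 : Δ.sd.rankPoly = chainPoly (Finset.univ.erase (⊥ : Δ.Face)) := by
    rw [rankPoly, chainPoly]
    refine Finset.sum_bij (fun (s : Δ.Flag) _ => (s.1 : Finset Δ.Face)) ?_ ?_ ?_ ?_
    · intro s _
      rw [Finset.mem_filter, Finset.mem_powerset]
      exact ⟨fun a ha => Finset.mem_erase.2 ⟨fun h => s.2.1 (h ▸ ha), Finset.mem_univ _⟩, s.2.2⟩
    · intro s _ t _ h
      exact Subtype.ext h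
    · intro s hs
      rw [Finset.mem_filter, Finset.mem_powerset] at hs
      exact ⟨⟨s, fun h => Finset.notMem_erase _ _ (hs.1 h), hs.2⟩, Finset.mem_univ _, rfl⟩
    · intro s _
      exact congrArg (X ^ ·) (Δ.rank_sd s)
  rw [h1, chainPoly_eq, rankPoly, map_sum]
  simp only [subdivOp_X_pow]
  rw [← Finset.add_sum_erase _ _ (Finset.mem_univ (⊥ : Δ.Face)), Δ.rank_eq_zero.2 rfl]
  congr 1
  refine Finset.sum_congr rfl fun A hA => ?_
  exact Δ.X_mul_chainPoly_lt _ A rfl (Finset.ne_of_mem_erase hA)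

theorem rankPoly_sd_iterate (n : ℕ) : (sd^[n] Δ).rankPoly = (subdivOp ^ n) Δ.rankPoly := by
  induction n with
  | zero => simp
  | succ n ih => rw [Function.iterate_succ_apply', rankPoly_sd, ih, pow_succ', Module.End.mul_apply]

theorem coeff_rankPoly (i : ℕ) : Δ.rankPoly.coeff i = Δ.fNum ((i : ℤ) - 1) := by
  classical
  have : Δ.fNum ((i : ℤ) - 1) = (Finset.univ.filter fun A => Δ.rank A = i).card := by
    rw [fNum, ← Nat.card_eq_finsetCard]
    refine Nat.card_congr (Equiv.subtypeEquivRight fun A => ?_)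
    rw [Finset.mem_filter, faceDim, sub_left_inj, Nat.cast_inj]
    simp [rank]
  rw [this, rankPoly, finsetSum_coeff, Finset.card_filter]
  push_cast
  refine Finset.sum_congr rfl fun A _ => ?_
  rw [coeff_X_pow]
  simp only [eq_comm]

theorem fNum_neg_one : Δ.fNum (-1) = 1 := by
  have h := Δ.coeff_rankPoly 0
  rw [Nat.cast_zero, zero_sub, rankPoly, finsetSum_coeff, Finset.sum_eq_single (⊥ : Δ.Face),
    Δ.rank_eq_zero.2 rfl] at h
  · simp at h
    exact_mod_cast h.symm
  · intro A _ hA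
    rw [coeff_X_pow, if_neg]
    exact fun h => hA (Δ.rank_eq_zero.1 h.symm)
  · simp

theorem dim_eq : Δ.dim = (Δ.rankPoly.natDegree : ℤ) - 1 := by
  have hne : Δ.rankPoly ≠ 0 := fun h => by
    have := Δ.coeff_rankPoly 0
    rw [Nat.cast_zero, zero_sub, fNum_neg_one, h] at this
    simp at this
  have hcoeff : ∀ A, Δ.rankPoly.coeff (Δ.rank A) ≠ 0 := fun A => by
    rw [coeff_rankPoly, Nat.cast_ne_zero, fNum]
    have : Nonempty {B : Δ.Face // Δ.faceDim B = (Δ.rank A : ℤ) - 1} := ⟨A, rfl⟩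
    exact Nat.card_pos.ne'
  rw [dim]
  refine le_antisymm (ciSup_le fun A => ?_) ?_
  · rw [faceDim]
    exact sub_le_sub_right (Nat.cast_le.2 (le_natDegree_of_ne_zero (hcoeff A))) 1
  · have h := leadingCoeff_ne_zero.2 hne
    rw [leadingCoeff, coeff_rankPoly, Nat.cast_ne_zero, fNum, Nat.card_ne_zero] at h
    obtain ⟨⟨A, hA⟩⟩ := h.1
    rw [← hA]
    exact le_ciSup (f := fun A => Δ.faceDim A) (Set.finite_range _).bddAbove A

theorem natDegree_rankPoly_sd : Δ.sd.rankPoly.natDegree = Δ.rankPoly.natDegree := by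
  rw [rankPoly_sd]
  refine le_antisymm (natDegree_subdivOp_le _) ?_
  by_cases h : Δ.rankPoly = 0
  · simp [h]
  · refine le_natDegree_of_ne_zero ?_
    rw [coeff_subdivOp_of_natDegree_le le_rfl]
    exact mul_ne_zero (by positivity) (leadingCoeff_ne_zero.2 h)

theorem dim_sd_iterate (n : ℕ) : (sd^[n] Δ).dim = Δ.dim := by
  induction n with
  | zero => rfl
  | succ n ih =>
    rw [Function.iterate_succ_apply', dim_eq, natDegree_rankPoly_sd, ← dim_eq, ih]

/-! ### The `h`-polynomial in terms of the rank polynomial -/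

variable {Δ} {d : ℕ}

theorem fPoly_eq (h : Δ.dim = (d : ℤ) - 1) :
    Δ.fPoly = X ^ d + ∑ i ∈ Finset.range d, C (Δ.fNum i : ℤ) * X ^ (d - (i + 1)) := by
  have hd : (Δ.dim + 1).toNat = d := by rw [h]; simp
  rw [fPoly, hd, Finset.sum_range_succ', add_comm]
  simp [fNum_neg_one]

theorem monic_hPoly (h : Δ.dim = (d : ℤ) - 1) : Δ.hPoly.Monic ∧ Δ.hPoly.natDegree = d := by
  have hdeg : (∑ i ∈ Finset.range d, C (Δ.fNum i : ℤ) * X ^ (d - (i + 1))).degree <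
      (d : WithBot ℕ) := by
    refine (degree_sum_le _ _).trans_lt ((Finset.sup_lt_iff (WithBot.bot_lt_coe d)).2 fun i hi => ?_)
    refine (degree_C_mul_X_pow_le _ _).trans_lt (Nat.cast_lt.2 ?_)
    have := Finset.mem_range.1 hi
    omega
  have hm : Δ.fPoly.Monic := by
    rw [fPoly_eq h]
    exact monic_X_pow_add hdeg
  have hn : Δ.fPoly.natDegree = d := by
    rw [fPoly_eq h, natDegree_add_eq_left_of_degree_lt (by rwa [degree_X_pow]), natDegree_X_pow]
  have hX : (X - 1 : ℤ[X]).natDegree = 1 := by rw [← C_1, natDegree_X_sub_C]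
  constructor
  · refine hm.comp ?_ (by rw [hX]; exact one_ne_zero)
    rw [← C_1]
    exact monic_X_sub_C 1
  · rw [hPoly, natDegree_comp, hn, hX, mul_one]

theorem eval_map_hPoly (h : Δ.dim = (d : ℤ) - 1) (t : ℝ) :
    (Δ.hPoly.map (Int.castRingHom ℝ)).eval t =
      ∑ i ∈ Finset.range (d + 1), Δ.rankPoly.coeff i * (t - 1) ^ (d - i) := by
  have hd : (Δ.dim + 1).toNat = d := by rw [h]; simp
  rw [hPoly, fPoly, hd, Polynomial.map_comp, eval_comp, Polynomial.map_sum, eval_finsetSum]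
  refine Finset.sum_congr rfl fun i _ => ?_
  rw [coeff_rankPoly]
  simp

theorem eval_one_map_hPoly (h : Δ.dim = (d : ℤ) - 1) :
    (Δ.hPoly.map (Int.castRingHom ℝ)).eval 1 = Δ.rankPoly.coeff d := by
  rw [eval_map_hPoly h, Finset.sum_range_succ, Finset.sum_eq_zero]
  · simp
  · intro i hi
    have := Finset.mem_range.1 hi
    rw [sub_self, zero_pow (by omega), mul_zero]

theorem eval_map_hPoly_one_add_inv (h : Δ.dim = (d : ℤ) - 1) {y : ℝ} (hy : y ≠ 0) :
    (Δ.hPoly.map (Int.castRingHom ℝ)).eval (1 + y⁻¹) * y ^ d = Δ.rankPoly.eval y := by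
  have hn : Δ.rankPoly.natDegree = d := by
    have := Δ.dim_eq
    omega
  rw [eval_map_hPoly h, eval_eq_sum_range, hn, Finset.sum_mul]
  refine Finset.sum_congr rfl fun i hi => ?_
  have hi' : i ≤ d := Nat.lt_succ_iff.1 (Finset.mem_range.1 hi)
  rw [add_sub_cancel_left, mul_assoc]
  congr 1
  rw [inv_pow, inv_mul_eq_div, div_eq_iff (pow_ne_zero _ hy), ← pow_add, Nat.add_sub_cancel' hi']

end BooleanCellComplex

/-! ### Enumerating the roots -/

theorem exists_prod_X_sub_C_eq {P : ℂ[X]} (hP : P.Monic) {d : ℕ} (hd : P.natDegree = d) :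
    ∃ β : Fin d → ℂ, ∏ i, (X - C (β i)) = P := by
  have hs := IsAlgClosed.splits P
  have h1 := hs.eq_prod_roots_of_monic hP
  have h2 := hs.natDegree_eq_card_roots
  rw [← P.roots.coe_toList] at h1 h2
  rw [Multiset.coe_card] at h2
  obtain rfl : P.roots.toList.length = d := h2.symm.trans hd
  refine ⟨fun i => P.roots.toList.get i, ?_⟩
  rw [Multiset.map_coe, Multiset.prod_coe] at h1
  rw [← List.prod_ofFn]
  conv_rhs => rw [h1]
  congr 1
  conv_rhs => rw [← List.ofFn_get P.roots.toList]
  rw [List.map_ofFn]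
  rfl

theorem exists_prod_mul_X_sub_C_eq {P : ℝ[X]} (hP : P.Monic) {m : ℕ} (hd : P.natDegree = m + 1)
    {r : Fin m → ℝ} (hr : Function.Injective r) (hroot : ∀ i, P.eval (r i) = 0) :
    ∃ s : ℝ, (∏ i, (X - C (r i))) * (X - C s) = P := by
  have hdvd : ∏ i, (X - C (r i)) ∣ P :=
    Finset.prod_dvd_of_coprime ((pairwise_coprime_X_sub_C hr).set_pairwise _)
      fun i _ => dvd_iff_isRoot.2 (hroot i)
  obtain ⟨B, hB⟩ := hdvd
  have hA : (∏ i, (X - C (r i))).Monic := monic_prod_of_monic _ _ fun i _ => monic_X_sub_C _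
  have hBm : B.Monic := hA.of_mul_monic_left (hB ▸ hP)
  have hn : B.natDegree = 1 := by
    have h := hA.natDegree_mul hBm
    rw [← hB, hd, natDegree_finsetProd_X_sub_C_eq_card] at h
    simp at h
    omega
  refine ⟨-B.coeff 0, ?_⟩
  rw [hB, map_neg, sub_neg_eq_add, ← hBm.eq_X_add_C hn]

/-- Root enumerations of a sequence of monic real polynomials, all of whose roots but one converge
to distinct nonpositive reals while the value at `1` tends to infinity. -/
theorem exists_root_sequences {m : ℕ} {P : ℕ → ℝ[X]} (hP : ∀ n, (P n).Monic)
    (hd : ∀ n, (P n).natDegree = m + 1) {ρ : Fin m → ℝ} (hρ : Function.Injective ρ)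
    (hρ1 : ∀ i, ρ i < 1) {r : ℕ → Fin m → ℝ} (hr : ∀ i, Tendsto (fun n => r n i) atTop (𝓝 (ρ i)))
    (hroot : ∀ i, ∀ᶠ n in atTop, (P n).eval (r n i) = 0)
    (hone : Tendsto (fun n => (P n).eval 1) atTop atTop) :
    ∃ β : ℕ → Fin (m + 1) → ℂ,
      (∀ᶠ n in atTop, ∀ i, (β n i).im = 0) ∧
      (∀ i : Fin m, Tendsto (fun n => β n i.castSucc) atTop (𝓝 (ρ i : ℂ))) ∧
      Tendsto (fun n => (β n (Fin.last m)).re) atTop atBot ∧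
      ∀ n, ∏ i, (X - C (β n i)) = (P n).map (algebraMap ℝ ℂ) := by
  have hinj : ∀ᶠ n in atTop, Function.Injective (r n) := by
    have : ∀ i j, ∀ᶠ n in atTop, i ≠ j → r n i ≠ r n j := fun i j => by
      by_cases hij : i = j
      · exact Eventually.of_forall fun n h => absurd hij h
      · have := ((hr i).sub (hr j)).eventually_ne (sub_ne_zero.2 (hρ.ne hij))
        filter_upwards [this] with n hn _
        exact sub_ne_zero.1 hn
    filter_upwards [eventually_all.2 fun i => eventually_all.2 (this i)] with n hn i j h
    by_contra hij
    exact hn i j hij h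
  -- Where the `r n i` are distinct roots, the last root is forced to be real. At the other indices,
  -- only finitely many, any complex enumeration serves.
  have hex : ∀ n, ∃ b : Fin (m + 1) → ℂ, ∏ i, (X - C (b i)) = (P n).map (algebraMap ℝ ℂ) ∧
      ((Function.Injective (r n) ∧ ∀ i, (P n).eval (r n i) = 0) → ∃ s : ℝ,
        (∏ i, (X - C (r n i))) * (X - C s) = P n ∧ (∀ i : Fin m, b i.castSucc = r n i) ∧
          b (Fin.last m) = s) := by
    intro n
    by_cases h : Function.Injective (r n) ∧ ∀ i, (P n).eval (r n i) = 0
    · obtain ⟨s, hs⟩ := exists_prod_mul_X_sub_C_eq (hP n) (hd n) h.1 h.2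
      refine ⟨Fin.snoc (fun i => (r n i : ℂ)) (s : ℂ), ?_, fun _ => ⟨s, hs, ?_, ?_⟩⟩
      · rw [Fin.prod_univ_castSucc, ← hs]
        simp [Polynomial.map_prod]
      · simp
      · simp
    · obtain ⟨b, hb⟩ := exists_prod_X_sub_C_eq ((hP n).map (algebraMap ℝ ℂ))
        ((natDegree_map _).trans (hd n))
      exact ⟨b, hb, fun h' => absurd h' h⟩
  choose β hβ hβ' using hex
  have hgood : ∀ᶠ n in atTop, Function.Injective (r n) ∧ ∀ i, (P n).eval (r n i) = 0 :=
    hinj.and (eventually_all.2 hroot)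
  refine ⟨β, ?_, ?_, ?_, hβ⟩
  · filter_upwards [hgood] with n hn i
    obtain ⟨s, -, h1, h2⟩ := hβ' n hn
    induction i using Fin.lastCases with
    | last => rw [h2, Complex.ofReal_im]
    | cast i => rw [h1, Complex.ofReal_im]
  · intro i
    have h := (Complex.continuous_ofReal.tendsto (ρ i)).comp (hr i)
    refine h.congr' ?_
    filter_upwards [hgood] with n hn
    obtain ⟨s, -, h1, -⟩ := hβ' n hn
    exact (h1 i).symm
  -- Evaluating the factorization at `1` gives the last root as `1 - P(1)/∏(1 - r i)`, with
  -- denominator tending to a positive limit.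
  · have hprod : Tendsto (fun n => (∏ i, (1 - r n i))⁻¹) atTop (𝓝 (∏ i, (1 - ρ i))⁻¹) :=
      (tendsto_finsetProd _ fun i _ => (hr i).const_sub 1).inv₀
        (Finset.prod_ne_zero_iff.2 fun i _ => (sub_pos.2 (hρ1 i)).ne')
    have hpos : 0 < (∏ i, (1 - ρ i))⁻¹ :=
      inv_pos.2 (Finset.prod_pos fun i _ => sub_pos.2 (hρ1 i))
    have hlim := tendsto_atBot_add_const_left atTop 1
      (tendsto_neg_atTop_atBot.comp (hone.atTop_mul_pos hpos hprod))
    refine hlim.congr' ?_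
    filter_upwards [hgood, hprod.eventually (lt_mem_nhds hpos)] with n hn hn'
    obtain ⟨s, hs, -, h2⟩ := hβ' n hn
    have hv := congrArg (eval 1) hs
    rw [eval_mul, eval_prod] at hv
    simp only [eval_sub, eval_X, eval_C] at hv
    have hne : (∏ i, (1 - r n i)) ≠ 0 := (inv_pos.1 hn').ne'
    rw [h2, Complex.ofReal_re, Function.comp_apply, ← hv]
    field_simp
    ring

/-! ### Limits of the roots -/

theorem BooleanCellComplex.exists_root_limits (e : ℕ) :
    ∃ α : Fin e → ℝ, (∀ i, α i < 0) ∧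
      ∀ Δ : BooleanCellComplex.{u}, Δ.dim = ((e + 2 : ℕ) : ℤ) - 1 →
        ∃ β : ℕ → Fin (e + 2) → ℂ,
          (∀ᶠ n in atTop, ∀ i, (β n i).im = 0) ∧
          (∀ i : Fin e, Tendsto (fun n => β n i.castSucc.castSucc) atTop (𝓝 (α i : ℂ))) ∧
          Tendsto (fun n => β n (Fin.last e).castSucc) atTop (𝓝 0) ∧
          Tendsto (fun n => (β n (Fin.last (e + 1))).re) atTop atBot ∧
          ∀ n : ℕ, ∏ i, (X - C (β n i)) =
            ((BooleanCellComplex.sd^[n] Δ).hPoly).map (Int.castRingHom ℂ) := by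
  have h2 : 2 ≤ e + 2 := by omega
  obtain ⟨q, hq⟩ := exists_isFactorialEigen h2
  obtain ⟨x, hxinj, hx⟩ := hq.exists_roots
  refine ⟨fun i => 1 + (x i)⁻¹, fun i => ?_, fun Δ hΔ => ?_⟩
  · have := (inv_lt_of_neg (hx i).2.2 (by norm_num : (-1 : ℝ) < 0)).2
      (by norm_num; exact (hx i).2.1)
    linarith
  have hdim : ∀ n, (BooleanCellComplex.sd^[n] Δ).dim = ((e + 2 : ℕ) : ℤ) - 1 := fun n =>
    (Δ.dim_sd_iterate n).trans hΔ
  have hdeg : Δ.rankPoly.natDegree = e + 2 := by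
    have := Δ.dim_eq
    omega
  set c := Δ.rankPoly.coeff (e + 2) with hc
  have hc0 : 0 < c := by
    refine lt_of_le_of_ne ?_ (Ne.symm ?_)
    · rw [hc, Δ.coeff_rankPoly]
      positivity
    · rw [hc, ← hdeg]
      exact leadingCoeff_ne_zero.2 fun h => by rw [h, natDegree_zero] at hdeg; omega
  -- The root `-1` goes last, since `1 + 1/(-1) = 0` is the next-to-last limit. The root `0` of `q`
  -- is left out: it corresponds to the root that escapes.
  set z : Fin (e + 1) → ℝ := Fin.snoc x (-1) with hz
  have hzroot : ∀ i, q.eval (z i) = 0 ∧ z i < 0 := fun i => by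
    induction i using Fin.lastCases with
    | last => rw [hz, Fin.snoc_last]; exact ⟨hq.eval_neg_one h2, by norm_num⟩
    | cast i => rw [hz, Fin.snoc_castSucc]; exact ⟨(hx i).1, (hx i).2.2⟩
  have hzinj : Function.Injective z := by
    rw [hz, Fin.snoc_injective_iff]
    exact ⟨hxinj, fun ⟨i, hi⟩ => (hx i).2.1.ne' hi⟩
  have hlim : ∀ t : ℝ, Tendsto (fun n => (c⁻¹ * (((e + 2).factorial : ℝ) ^ n)⁻¹) *
      (BooleanCellComplex.sd^[n] Δ).rankPoly.eval t) atTop (𝓝 (q.eval t)) := fun t => by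
    have h := (hq.tendsto_scaled_aeval h2 hdeg.le t).const_mul c⁻¹
    rw [smul_eq_mul, ← hc, inv_mul_cancel_left₀ hc0.ne', coe_aeval_eq_eval] at h
    refine h.congr fun n => ?_
    rw [Δ.rankPoly_sd_iterate, smul_eq_mul, mul_assoc]
  have hy := fun i => exists_tendsto_roots hlim
    (fun n => mul_ne_zero (inv_ne_zero hc0.ne') (inv_ne_zero (by positivity)))
    (hzroot i).1 (hq.simple_roots h2 (hzroot i).1)
  choose y hylim hyroot using hy
  obtain ⟨β, hβ1, hβ2, hβ3, hβ4⟩ := exists_root_sequences (m := e + 1)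
    (P := fun n => (BooleanCellComplex.sd^[n] Δ).hPoly.map (Int.castRingHom ℝ))
    (fun n => (monic_hPoly (hdim n)).1.map _)
    (fun n => by
      rw [natDegree_map_eq_of_injective (RingHom.injective_int _), (monic_hPoly (hdim n)).2])
    (ρ := fun i => 1 + (z i)⁻¹) (fun i j h => hzinj (by simpa using h))
    (fun i => by have := inv_lt_zero.2 (hzroot i).2; linarith)
    (r := fun n i => 1 + (y i n)⁻¹)
    (fun i => ((hylim i).inv₀ (hzroot i).2.ne).const_add 1)
    (fun i => by
      filter_upwards [hyroot i, (hylim i).eventually_ne (hzroot i).2.ne] with n hn hn0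
      have h := eval_map_hPoly_one_add_inv (hdim n) hn0
      rw [hn] at h
      exact (mul_eq_zero.1 h).resolve_right (pow_ne_zero _ hn0))
    (by
      have hf : (1 : ℝ) < (e + 2).factorial := by
        exact_mod_cast factorial_lt_factorial_of_two_le (i := 0) h2 (by omega)
      refine ((tendsto_pow_atTop_atTop_of_one_lt hf).atTop_mul_const hc0).congr fun n => ?_
      rw [eval_one_map_hPoly (hdim n), rankPoly_sd_iterate, coeff_subdivOp_pow hdeg.le])
  refine ⟨β, hβ1, fun i => ?_, ?_, hβ3, fun n => ?_⟩
  · have h := hβ2 i.castSucc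
    rwa [hz, Fin.snoc_castSucc] at h
  · have h := hβ2 (Fin.last e)
    rw [hz, Fin.snoc_last] at h
    simpa using h
  · rw [hβ4, Polynomial.map_map]
    congr 1

theorem theorem4p2 (d : ℕ) (hd : 2 ≤ d) :
    ∃ α : Fin (d - 2) → ℝ, (∀ i, α i < 0) ∧
      ∀ Δ : BooleanCellComplex.{u}, Δ.dim = (d : ℤ) - 1 →
        ∃ β : ℕ → Fin d → ℂ,
          (∀ᶠ n in atTop, ∀ i, (β n i).im = 0) ∧
          (∀ i : Fin (d - 2),
            Tendsto (fun n => β n ⟨i, by omega⟩) atTop (𝓝 (α i : ℂ))) ∧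
          Tendsto (fun n => β n ⟨d - 2, by omega⟩) atTop (𝓝 0) ∧
          Tendsto (fun n => (β n ⟨d - 1, by omega⟩).re) atTop atBot ∧
          ∀ n : ℕ, 1 ≤ n →
            ∏ i, (X - C (β n i)) =
              ((BooleanCellComplex.sd^[n] Δ).hPoly).map (Int.castRingHom ℂ) := by
  obtain ⟨e, rfl⟩ := Nat.exists_eq_add_of_le' hd
  obtain ⟨α, hα, h⟩ := BooleanCellComplex.exists_root_limits.{u} e
  refine ⟨α, hα, fun Δ hΔ => ?_⟩
  obtain ⟨β, h1, h2, h3, h4, h5⟩ := h Δ hΔ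
  exact ⟨β, h1, h2, h3, h4, fun n _ => h5 n⟩
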